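/- Let $k\ge 2$, let $\mu_1,\dots,\mu_k\in\mathbb{R}$ and $\sigma_1,\dots,\sigma_k>0$, and let $b$ be the unique best arm, i.e. $\mu_b>\mu_i$ for all $i\ne b$. Let the rewards $X_{i,t}\sim\mathcal{N}(\mu_i,\sigma_i^2)$ ($i=1,\dots,k$, $t=1,2,\dots$) be independent over all arms and rounds. The knowledge gradient (KG) algorithm with non-informative prior starts from $\theta_{i,1}=0$, $\lambda_{i,1}^2=\infty$ for all $i$. In each round $t=1,2,\dots$ it pulls an arm $I_t$ that maximizes $$v_{i,t}=\zeta_{i,t}\,f\!\left(-\frac{\left|\theta_{i,t}-\max_{j\ne i}\theta_{j,t}\right|}{\zeta_{i,t}}\right),\qquad \zeta_{i,t}^2=\lambda_{i,t}^2-\left(\lambda_{i,t}^{-2}+\sigma_i^{-2}\right)^{-1},\qquad f(x)=x\Phi(x)+\phi(x),$$ over $i\in\{1,\dots,k\}$, where $\Phi$ and $\phi$ are the standard normal distribution function and density, and $v_{i,t}=\infty$ if $\lambda_{i,t}^2=\infty$. Ties are broken in any way that does not anticipate the future: $I_t$ is a function of information which contains the rewards of the rounds before $t$, possibly together with external randomness,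 and which is independent of the rewards of round $t$. It then observes $X_{I_t,t}$ and sets, for the arm $i=I_t$, $$\theta_{i,t+1}=\frac{\lambda_{i,t}^{-2}\theta_{i,t}+\sigma_i^{-2}X_{i,t}}{\lambda_{i,t}^{-2}+\sigma_i^{-2}},\qquad \lambda_{i,t+1}^2=\left(\lambda_{i,t}^{-2}+\sigma_i^{-2}\right)^{-1},$$ leaving $\theta_{i,t+1}=\theta_{i,t}$, $\lambda_{i,t+1}^2=\lambda_{i,t}^2$ for the arms $i\ne I_t$. Let $N_{i,t}=\#\{s\le t: I_s=i\}$ be the number of pulls of arm $i$ in the first $t$ rounds. Then, almost surely, $$\lim_{t\to\infty}\frac{N_{i,t}}{N_{b,t}}=\frac{\sigma_i}{\sigma_b}\,\frac{\mu_b-\max_{j\ne b}\mu_j}{\mu_b-\mu_i}\quad\text{for all } i\ne b,$$ $$\lim_{t\to\infty}\frac{N_{i_1,t}}{N_{i_2,t}}=\frac{\sigma_{i_1}}{\sigma_{i_2}}\,\frac{\mu_b-\mu_{i_2}}{\mu_b-\mu_{i_1}}\quad\text{for all } i_1,i_2\ne b.$$ -/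

import Mathlib

open MeasureTheory ProbabilityTheory Filter
open scoped ENNReal NNReal Topology

noncomputable section

namespace KG

/-- The knowledge about `k` arms: the posterior of the mean of arm `i` is normal with mean
`mean i` and variance `var i`; the variance may be infinite (non-informative prior). -/
structure Knowledge (k : ℕ) where
  mean : Fin k → ℝ
  var : Fin k → ℝ≥0∞

/-- The non-informative prior: means zero, variances infinite. -/
def prior (k : ℕ) : Knowledge k where
  mean := fun _ => 0
  var := fun _ => ∞

/-- Posterior variance `(l⁻¹ + s⁻²)⁻¹` after one observation with standard deviation `s`,
if the current variance is `l` (with `∞⁻¹ = 0`). -/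
def postVar (s : ℝ) (l : ℝ≥0∞) : ℝ≥0∞ :=
  (l⁻¹ + (ENNReal.ofReal (s ^ 2))⁻¹)⁻¹

/-- Posterior mean `(l⁻¹ θ + s⁻² x) / (l⁻¹ + s⁻²)` after observing `x` with standard deviation
`s`, if the current mean and variance are `θ` and `l` (with `∞⁻¹ = 0`). -/
def postMean (s : ℝ) (θ : ℝ) (l : ℝ≥0∞) (x : ℝ) : ℝ :=
  ((l⁻¹).toReal * θ + (s ^ 2)⁻¹ * x) / ((l⁻¹).toReal + (s ^ 2)⁻¹)

/-- Bayesian update after pulling arm `a` and observing the reward `x`. -/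
def Knowledge.update {k : ℕ} (σ : Fin k → ℝ) (S : Knowledge k) (a : Fin k) (x : ℝ) :
    Knowledge k where
  mean := fun i => if a = i then postMean (σ i) (S.mean i) (S.var i) x else S.mean i
  var := fun i => if a = i then postVar (σ i) (S.var i) else S.var i

/-- The knowledge at the beginning of round `t` (rounds are numbered `0, 1, 2, …`), when arm
`I s` is pulled in round `s` and `x i s` is the reward that arm `i` offers in round `s`. -/
def knowledge {k : ℕ} (σ : Fin k → ℝ) (I : ℕ → Fin k) (x : Fin k → ℕ → ℝ) : ℕ → Knowledge k
  | 0 => prior k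
  | t + 1 => (knowledge σ I x t).update σ (I t) (x (I t) t)

/-- `f x = x Φ(x) + φ(x)` for the standard normal distribution function `Φ` and density `φ`. -/
def f (x : ℝ) : ℝ :=
  x * cdf (gaussianReal 0 1) x + gaussianPDFReal 0 1 x

/-- `ζ_i`, the square root of the decrease of the variance of arm `i` when it is pulled once. -/
def zeta {k : ℕ} (σ : Fin k → ℝ) (S : Knowledge k) (i : Fin k) : ℝ≥0∞ :=
  (S.var i - postVar (σ i) (S.var i)) ^ (1 / 2 : ℝ)

/-- The knowledge gradient `ζ_i f(-|θ_i - max_{j ≠ i} θ_j| / ζ_i)` of arm `i`. It is computed in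
`[0, ∞]`: for `ζ_i = ∞` (an arm not pulled yet) the quotient is zero and the value is
`∞ * f 0 = ∞`. -/
def value {k : ℕ} (σ : Fin k → ℝ) (S : Knowledge k) (i : Fin k) : ℝ≥0∞ :=
  zeta σ S i * ENNReal.ofReal
    (f (-(ENNReal.ofReal |S.mean i - ⨆ j : {j : Fin k // j ≠ i}, S.mean j| / zeta σ S i).toReal))

/-- `I` is a run of the knowledge gradient algorithm for the rewards `x`: in every round the arm
pulled has the largest knowledge gradient (ties may be broken in any way). -/
def IsRun {k : ℕ} (σ : Fin k → ℝ) (x : Fin k → ℕ → ℝ) (I : ℕ → Fin k) : Prop :=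
  ∀ t, ∀ j, value σ (knowledge σ I x t) j ≤ value σ (knowledge σ I x t) (I t)

/-- The number of pulls of arm `i` in the first `t` rounds. -/
def pulls {k : ℕ} (I : ℕ → Fin k) (i : Fin k) (t : ℕ) : ℕ :=
  ((Finset.range t).filter fun s => I s = i).card

/-- Independent normal rewards: arm `i` offers `X i t ∼ N(μ i, (σ i)²)` in round `t`, independently
over all arms and rounds. -/
structure IsRewards {k : ℕ} {Ω : Type*} [MeasurableSpace Ω] (P : Measure Ω) (μ σ : Fin k → ℝ)
    (X : Fin k → ℕ → Ω → ℝ) : Prop where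
  measurable : ∀ i t, Measurable (X i t)
  law : ∀ i t, P.map (X i t) = gaussianReal (μ i) (Real.toNNReal (σ i ^ 2))
  indep : iIndepFun (fun p : Fin k × ℕ => X p.1 p.2) P

/-- The arms `I` are chosen without anticipation: `I t` is a function of the information `ℱ t`
available before round `t`, which contains the rewards of the earlier rounds (and possibly
external randomness for breaking ties) and is independent of the rewards of round `t`. -/
structure IsNonanticipating {k : ℕ} {Ω : Type*} [mΩ : MeasurableSpace Ω] (P : Measure Ω)
    (ℱ : Filtration ℕ mΩ) (X : Fin k → ℕ → Ω → ℝ) (I : ℕ → Ω → Fin k) : Prop where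
  choice : ∀ t, Measurable[ℱ t] (I t)
  past : ∀ i s t, s < t → Measurable[ℱ t] (X i s)
  indep : ∀ t, Indep (ℱ t) (MeasurableSpace.comap (fun ω i => X i t ω) inferInstance) P

end KG

end

/-!
An arm `i` that has been pulled `n ≥ 1` times has posterior variance `σ i ^ 2 / n`, so that
`ζ i = σ i / √(n (n + 1))` and its knowledge gradient is `ζ i * f (-(Δ i / ζ i))`, where `Δ i`
(`KG.gap`) is the distance of its sample mean to the best sample mean of the other arms.

*Consistency.* The rewards collected from an arm, centred and divided by the number of pulls, sum
up to a martingale bounded in `L²`, since `∑ n⁻² < ∞`. It converges almost surely, and Kronecker's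
lemma shows that the sample mean of every arm pulled infinitely often converges to the true mean
(`KG.ae_tendsto_total_div_pulls`). The remaining arguments are deterministic, on a path where this
holds. All sample means converge, so an arm pulled finitely often would keep a knowledge gradient
bounded away from zero, while the knowledge gradients of the arms pulled infinitely often tend to
zero. Hence every arm is pulled infinitely often (`KG.tendsto_pulls_atTop`), and `Δ i` converges to
its value for the true means.

*Balance.* The bounds `φ (g + 2) ≤ f (-g) ≤ φ g` for `g ≥ 0` (`KG.le_f_neg`, `KG.f_neg_le`) suffice
to see that a knowledge gradient decays like a Gaussian tail in `Δ i / ζ i ≈ n Δ i / σ i`. When arm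
`i` is pulled, `Δ i / ζ i` is therefore at most `1 + ε` times `Δ j / ζ j` for every other arm `j`
(`KG.eventually_div_step_le`). As the number of pulls of `i` changes only in such rounds, this
gives `limsup N i / N j ≤ (Δ j / σ j) / (Δ i / σ i)`, and exchanging `i` and `j` gives the limit
(`KG.tendsto_pulls_div_pulls`).
-/

namespace KG

/-! ### Gaussian bounds for `f` -/

lemma gaussianPDFReal_zero_one (x : ℝ) :
    gaussianPDFReal 0 1 x = (√(2 * Real.pi))⁻¹ * Real.exp (-x ^ 2 / 2) := by
  simp [gaussianPDFReal]

lemma gaussianPDFReal_zero_one_neg (x : ℝ) :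
    gaussianPDFReal 0 1 (-x) = gaussianPDFReal 0 1 x := by
  simp [gaussianPDFReal_zero_one]

lemma gaussianPDFReal_zero_one_anti {x y : ℝ} (hx : 0 ≤ x) (hxy : x ≤ y) :
    gaussianPDFReal 0 1 y ≤ gaussianPDFReal 0 1 x := by
  rw [gaussianPDFReal_zero_one, gaussianPDFReal_zero_one]
  have : x ^ 2 ≤ y ^ 2 := pow_le_pow_left₀ hx hxy 2
  gcongr

lemma hasDerivAt_gaussianPDFReal_zero_one (x : ℝ) :
    HasDerivAt (gaussianPDFReal 0 1) (-x * gaussianPDFReal 0 1 x) x := by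
  have h : HasDerivAt (fun y : ℝ => (√(2 * Real.pi))⁻¹ * Real.exp (-y ^ 2 / 2))
      ((√(2 * Real.pi))⁻¹ * (Real.exp (-x ^ 2 / 2) * (-x))) x := by
    refine HasDerivAt.const_mul _ (HasDerivAt.exp ?_)
    exact ((hasDerivAt_pow 2 x).neg.div_const 2).congr_deriv (by push_cast; ring)
  rw [show gaussianPDFReal 0 1 = fun y : ℝ => (√(2 * Real.pi))⁻¹ * Real.exp (-y ^ 2 / 2) from
    funext gaussianPDFReal_zero_one]
  exact h.congr_deriv (by ring)

lemma integrable_id_mul_gaussianPDFReal_zero_one :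
    Integrable fun x : ℝ => x * gaussianPDFReal 0 1 x := by
  have h := (integrable_mul_exp_neg_mul_sq (b := 1 / 2) (by norm_num)).const_mul
    (√(2 * Real.pi))⁻¹
  refine h.congr (ae_of_all _ fun x => ?_)
  simp only [gaussianPDFReal_zero_one]
  rw [show -(1 / 2) * x ^ 2 = -x ^ 2 / 2 by ring]
  ring

lemma tendsto_gaussianPDFReal_zero_one_atBot :
    Tendsto (gaussianPDFReal 0 1) atBot (𝓝 0) := by
  rw [show gaussianPDFReal 0 1 = fun y : ℝ => (√(2 * Real.pi))⁻¹ * Real.exp (-y ^ 2 / 2) from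
    funext gaussianPDFReal_zero_one]
  rw [← mul_zero (√(2 * Real.pi))⁻¹]
  refine Tendsto.const_mul _ (Real.tendsto_exp_atBot.comp ?_)
  have h : Tendsto (fun y : ℝ => y ^ 2) atBot atTop := by
    simpa [Function.comp_def] using
      (tendsto_pow_atTop (α := ℝ) (n := 2) (by norm_num)).comp tendsto_abs_atBot_atTop
  have h2 := (tendsto_neg_atTop_atBot.comp h).atBot_div_const (r := 2) (by norm_num)
  exact h2

/-- `f x` is the expectation of the positive part of `x - Z` for a standard normal `Z`. -/
lemma f_eq_setIntegral (x : ℝ) :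
    f x = ∫ z in Set.Iic x, (x - z) * gaussianPDFReal 0 1 z := by
  have h1 : cdf (gaussianReal 0 1) x = ∫ z in Set.Iic x, gaussianPDFReal 0 1 z := by
    rw [cdf_eq_real, measureReal_def, gaussianReal_apply_eq_integral 0 one_ne_zero,
      ENNReal.toReal_ofReal]
    exact integral_nonneg fun z => gaussianPDFReal_nonneg _ _ _
  have h2 : ∫ z in Set.Iic x, -z * gaussianPDFReal 0 1 z = gaussianPDFReal 0 1 x - 0 := by
    refine integral_Iic_of_hasDerivAt_of_tendsto'
      (fun z _ => hasDerivAt_gaussianPDFReal_zero_one z) ?_ tendsto_gaussianPDFReal_zero_one_atBot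
    simpa using integrable_id_mul_gaussianPDFReal_zero_one.neg.integrableOn
  have h3 : ∀ z : ℝ, (x - z) * gaussianPDFReal 0 1 z
      = x * gaussianPDFReal 0 1 z + -z * gaussianPDFReal 0 1 z := fun z => by ring
  simp_rw [h3]
  rw [integral_add ((integrable_gaussianPDFReal 0 1).const_mul x).integrableOn
    (by simpa using integrable_id_mul_gaussianPDFReal_zero_one.restrict),
    integral_const_mul, h2, ← h1, f, sub_zero]

lemma f_neg_le {g : ℝ} (hg : 0 ≤ g) : f (-g) ≤ gaussianPDFReal 0 1 g := by
  have := mul_nonneg hg (cdf_nonneg (gaussianReal 0 1) (-g))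
  rw [f, gaussianPDFReal_zero_one_neg]
  linarith

/-- A crude Gaussian lower bound: the integrand `(-g - z) φ(z)` is at least `φ(g + 2)` for
`z ∈ (-g - 2, -g - 1]`. -/
lemma le_f_neg {g : ℝ} (hg : 0 ≤ g) : gaussianPDFReal 0 1 (g + 2) ≤ f (-g) := by
  have hint : Integrable fun z : ℝ => (-g - z) * gaussianPDFReal 0 1 z := by
    have := ((integrable_gaussianPDFReal 0 1).const_mul (-g)).sub
      integrable_id_mul_gaussianPDFReal_zero_one
    refine this.congr (ae_of_all _ fun z => ?_)
    simp only [Pi.sub_apply]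
    ring
  have h1 : ∫ _z in Set.Ioc (-g - 2) (-g - 1), gaussianPDFReal 0 1 (g + 2)
      ≤ ∫ z in Set.Ioc (-g - 2) (-g - 1), (-g - z) * gaussianPDFReal 0 1 z := by
    refine setIntegral_mono_on (by simp) hint.integrableOn measurableSet_Ioc fun z hz => ?_
    have h2 : gaussianPDFReal 0 1 (g + 2) ≤ gaussianPDFReal 0 1 z := by
      rw [← gaussianPDFReal_zero_one_neg z]
      exact gaussianPDFReal_zero_one_anti (by linarith [hz.2]) (by linarith [hz.1])
    have h3 := gaussianPDFReal_nonneg 0 1 z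
    nlinarith [hz.2]
  have h2 : ∫ z in Set.Ioc (-g - 2) (-g - 1), (-g - z) * gaussianPDFReal 0 1 z
      ≤ ∫ z in Set.Iic (-g), (-g - z) * gaussianPDFReal 0 1 z := by
    refine setIntegral_mono_set hint.integrableOn ?_ ?_
    · refine (ae_restrict_iff' measurableSet_Iic).2 (ae_of_all _ fun z hz => ?_)
      exact mul_nonneg (sub_nonneg.2 hz) (gaussianPDFReal_nonneg _ _ _)
    · exact LE.le.eventuallyLE fun z hz => hz.2.trans (by linarith)
  rw [f_eq_setIntegral]
  refine le_trans (le_of_eq ?_) (h1.trans h2)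
  rw [setIntegral_const, measureReal_def, Real.volume_Ioc]
  norm_num

lemma f_neg_pos {g : ℝ} (hg : 0 ≤ g) : 0 < f (-g) :=
  (gaussianPDFReal_pos 0 1 _ one_ne_zero).trans_le (le_f_neg hg)

/-- A normal tail at a proportionally larger argument is negligible. -/
lemma eventually_gaussianPDFReal_lt {ε C : ℝ} (hε : 0 < ε) (hC : 0 < C) :
    ∀ᶠ g in atTop, gaussianPDFReal 0 1 ((1 + ε) * g) < C * gaussianPDFReal 0 1 (g + 2) := by
  have h : Tendsto (fun g : ℝ => (ε * g - 2) * (g + 2) / 2) atTop atTop := by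
    refine Tendsto.atTop_div_const (by norm_num) (Tendsto.atTop_mul_atTop₀ ?_ ?_)
    · exact tendsto_atTop_add_const_right _ _ (tendsto_id.const_mul_atTop hε)
    · exact tendsto_atTop_add_const_right _ _ tendsto_id
  filter_upwards [h.eventually_gt_atTop (-Real.log C), eventually_ge_atTop (0 : ℝ),
    (tendsto_id.const_mul_atTop hε).eventually_ge_atTop 2] with g hg hg0 hg2
  rw [gaussianPDFReal_zero_one, gaussianPDFReal_zero_one]
  have h1 : Real.exp (-((1 + ε) * g) ^ 2 / 2)
      < Real.exp (Real.log C + -(g + 2) ^ 2 / 2) := by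
    refine Real.exp_lt_exp.2 ?_
    simp only [id] at hg2
    -- `((1 + ε) g)² - (g + 2)² = (ε g - 2) ((2 + ε) g + 2) ≥ (ε g - 2) (g + 2)`
    nlinarith [mul_nonneg (sub_nonneg.2 hg2) hg0,
      mul_nonneg (mul_nonneg (sub_nonneg.2 hg2) hg0) hε.le]
  rw [Real.exp_add, Real.exp_log hC] at h1
  have : 0 < (√(2 * Real.pi))⁻¹ := by positivity
  calc _ < (√(2 * Real.pi))⁻¹ * (C * Real.exp (-(g + 2) ^ 2 / 2)) := by gcongr
    _ = _ := by ring

/-! ### Strong law of large numbers for an adaptively sampled arm -/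

section Martingale

variable {Ω : Type*} [mΩ : MeasurableSpace Ω] {P : Measure Ω} [IsProbabilityMeasure P]

/-- The martingale transform of independent centred square-integrable variables by a predictable
sequence `c` converges almost surely if `∑ c²` is bounded, because the transform is then a
martingale bounded in `L²`. -/
lemma ae_exists_tendsto_sum_predictable_mul (ℱ : Filtration ℕ mΩ) {c Y : ℕ → Ω → ℝ} {B V : ℝ}
    (hc : ∀ t, Measurable[ℱ t] (c t)) (hc1 : ∀ t ω, |c t ω| ≤ 1)
    (hcB : ∀ t ω, ∑ s ∈ Finset.range t, c s ω ^ 2 ≤ B)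
    (hYm : ∀ s t, s < t → Measurable[ℱ t] (Y s)) (hY2 : ∀ t, MemLp (Y t) 2 P)
    (hY0 : ∀ t, ∫ ω, Y t ω ∂P = 0) (hYV : ∀ t, ∫ ω, Y t ω ^ 2 ∂P = V)
    (hind : ∀ t, Indep (ℱ t) (MeasurableSpace.comap (Y t) inferInstance) P) :
    ∀ᵐ ω ∂P, ∃ U, Tendsto (fun t => ∑ s ∈ Finset.range t, c s ω * Y s ω) atTop (𝓝 U) := by
  set M : ℕ → Ω → ℝ := fun t ω => ∑ s ∈ Finset.range t, c s ω * Y s ω with hM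
  have hcm : ∀ t, Measurable (c t) := fun t => (hc t).mono (ℱ.le t) le_rfl
  have hYm' : ∀ t, Measurable (Y t) := fun t =>
    (hYm t (t + 1) t.lt_succ_self).mono (ℱ.le _) le_rfl
  have hD2 : ∀ t, MemLp (fun ω => c t ω * Y t ω) 2 P := fun t => by
    refine (hY2 t).of_le ((hcm t).mul (hYm' t)).aestronglyMeasurable (ae_of_all _ fun ω => ?_)
    rw [norm_mul]
    exact mul_le_of_le_one_left (norm_nonneg _) (hc1 t ω)
  have hM2 : ∀ t, MemLp (M t) 2 P := fun t => memLp_finsetSum _ fun s _ => hD2 s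
  have hMm : ∀ t, Measurable[ℱ t] (M t) := fun t =>
    Finset.measurable_fun_sum _ fun s hs =>
      (((hc s).mono (ℱ.mono (Finset.mem_range.1 hs).le) le_rfl).mul
        (hYm s t (Finset.mem_range.1 hs)))
  have hindep : ∀ t (Z : Ω → ℝ), Measurable[ℱ t] Z → IndepFun Z (Y t) P := fun t Z hZ =>
    (IndepFun_iff_Indep _ _ _).2 (indep_of_indep_of_le_left (hind t) hZ.comap_le)
  have hsucc : ∀ t, M (t + 1) = fun ω => M t ω + c t ω * Y t ω := fun t => by
    funext ω
    simp [hM, Finset.sum_range_succ]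
  have hmart : Martingale M ℱ P := by
    refine martingale_of_condExp_sub_eq_zero_nat (fun t => (hMm t).stronglyMeasurable)
      (fun t => (hM2 t).integrable one_le_two) fun t => ?_
    have h1 : M (t + 1) - M t = c t * Y t := by
      funext ω
      simp [hsucc]
    have h2 := condExp_mul_of_stronglyMeasurable_left (μ := P) (hc t).stronglyMeasurable
      ((hD2 t).integrable one_le_two) ((hY2 t).integrable one_le_two)
    have h3 := condExp_indep_eq (μ := P) (hYm' t).comap_le (ℱ.le t)
      (comap_measurable (Y t)).stronglyMeasurable (hind t).symm
    rw [h1]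
    filter_upwards [h2, h3] with ω h2 h3
    rw [h2, Pi.mul_apply, h3, hY0]
    simp
  have hsq : ∀ t, ∫ ω, M t ω ^ 2 ∂P = V * ∫ ω, ∑ s ∈ Finset.range t, c s ω ^ 2 ∂P := by
    have hc2 : ∀ t, Integrable (fun ω => c t ω ^ 2) P := fun t => by
      refine Integrable.of_bound ((hcm t).pow_const 2).aestronglyMeasurable 1
        (ae_of_all _ fun ω => ?_)
      rw [norm_pow]
      exact pow_le_one₀ (norm_nonneg _) (hc1 t ω)
    intro t
    induction t with
    | zero => simp [hM]
    | succ t ih =>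
      have hMc : Integrable (fun ω => M t ω * c t ω * Y t ω) P := by
        simpa [Pi.mul_def, mul_assoc] using (hM2 t).integrable_mul (hD2 t)
      have hcross : ∫ ω, M t ω * c t ω * Y t ω ∂P = 0 := by
        have := (hindep t _ ((hMm t).mul (hc t))).integral_fun_mul_eq_mul_integral
          ((((hMm t).mul (hc t))).mono (ℱ.le t) le_rfl).aestronglyMeasurable
          (hYm' t).aestronglyMeasurable
        simpa [hY0] using this
      have hdiag : ∫ ω, (c t ω * Y t ω) ^ 2 ∂P = V * ∫ ω, c t ω ^ 2 ∂P := by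
        have := ((hindep t _ (hc t)).comp (measurable_id.pow_const 2)
          (measurable_id.pow_const 2)).integral_fun_mul_eq_mul_integral
          ((hcm t).pow_const 2).aestronglyMeasurable ((hYm' t).pow_const 2).aestronglyMeasurable
        simp only [Function.comp_apply, id] at this
        simp_rw [mul_pow]
        rw [this, mul_comm, ← hYV t]
      simp_rw [hsucc, Finset.sum_range_succ]
      rw [integral_add (integrable_finsetSum _ fun s _ => hc2 s) (hc2 t), mul_add, ← ih, ← hdiag]
      have hexp : ∀ ω, (M t ω + c t ω * Y t ω) ^ 2
          = M t ω ^ 2 + (2 * (M t ω * c t ω * Y t ω) + (c t ω * Y t ω) ^ 2) := fun ω => by ring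
      simp_rw [hexp]
      have hrest : Integrable
          (fun ω => 2 * (M t ω * c t ω * Y t ω) + (c t ω * Y t ω) ^ 2) P :=
        (hMc.const_mul 2).add (hD2 t).integrable_sq
      rw [integral_add (hM2 t).integrable_sq hrest,
        integral_add (hMc.const_mul 2) (hD2 t).integrable_sq, integral_const_mul, hcross]
      ring
  have hV : 0 ≤ V := hYV 0 ▸ integral_nonneg fun ω => sq_nonneg _
  have hbound : ∀ t, eLpNorm (M t) 1 P ≤ (Real.toNNReal (1 + V * B) : ℝ≥0∞) := fun t => by
    rw [eLpNorm_one_eq_lintegral_enorm, ← ofReal_integral_norm_eq_lintegral_enorm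
      ((hM2 t).integrable one_le_two)]
    refine ENNReal.ofReal_le_ofReal ?_
    calc ∫ ω, ‖M t ω‖ ∂P ≤ ∫ ω, (1 + M t ω ^ 2) ∂P := by
          refine integral_mono ((hM2 t).integrable one_le_two).norm
            ((integrable_const _).add (hM2 t).integrable_sq) fun ω => ?_
          simp only [Real.norm_eq_abs]
          nlinarith [sq_abs (M t ω), sq_nonneg (|M t ω| - 1)]
      _ = 1 + V * ∫ ω, ∑ s ∈ Finset.range t, c s ω ^ 2 ∂P := by
          rw [integral_add (integrable_const _) (hM2 t).integrable_sq, hsq]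
          simp
      _ ≤ 1 + V * B := by
          gcongr
          calc ∫ ω, ∑ s ∈ Finset.range t, c s ω ^ 2 ∂P ≤ ∫ _ω, B ∂P :=
                integral_mono_of_nonneg
                  (ae_of_all _ fun ω => Finset.sum_nonneg fun s _ => sq_nonneg _)
                  (integrable_const _) (ae_of_all _ fun ω => hcB t ω)
            _ = B := by simp
  exact hmart.submartingale.exists_ae_tendsto_of_bdd hbound

end Martingale

lemma pulls_zero {k : ℕ} (I : ℕ → Fin k) (i : Fin k) : pulls I i 0 = 0 := rfl

lemma pulls_succ {k : ℕ} (I : ℕ → Fin k) (i : Fin k) (t : ℕ) :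
    pulls I i (t + 1) = pulls I i t + if I t = i then 1 else 0 := by
  unfold pulls
  rw [Finset.range_add_one, Finset.filter_insert]
  split_ifs <;> simp

lemma pulls_mono {k : ℕ} (I : ℕ → Fin k) (i : Fin k) : Monotone (pulls I i) :=
  monotone_nat_of_le_succ fun t => by rw [pulls_succ]; exact Nat.le_add_right _ _

/-- The sum of the rewards collected from arm `i` in the first `t` rounds. -/
noncomputable def total {k : ℕ} (I : ℕ → Fin k) (x : Fin k → ℕ → ℝ) (i : Fin k) (t : ℕ) : ℝ :=
  ∑ s ∈ Finset.range t, if I s = i then x i s else 0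

lemma total_succ {k : ℕ} (I : ℕ → Fin k) (x : Fin k → ℕ → ℝ) (i : Fin k) (t : ℕ) :
    total I x i (t + 1) = total I x i t + if I t = i then x i t else 0 :=
  Finset.sum_range_succ _ _

/-- The weight `1 / n` given to the reward of the `n`-th pull of arm `i`, and zero in the rounds
in which another arm is pulled. -/
noncomputable def weight {k : ℕ} (I : ℕ → Fin k) (i : Fin k) (t : ℕ) : ℝ :=
  if I t = i then ((pulls I i t : ℝ) + 1)⁻¹ else 0

lemma abs_weight_le_one {k : ℕ} (I : ℕ → Fin k) (i : Fin k) (t : ℕ) : |weight I i t| ≤ 1 := by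
  unfold weight
  split_ifs
  · rw [abs_of_nonneg (by positivity)]
    exact inv_le_one_of_one_le₀ (by simp)
  · simp

lemma sum_weight_sq_le {k : ℕ} (I : ℕ → Fin k) (i : Fin k) (t : ℕ) :
    ∑ s ∈ Finset.range t, weight I i s ^ 2 ≤ 2 := by
  -- The bound `∑_{m ≤ n} m⁻² ≤ 2 - 2 / (n + 1)` is preserved by every further pull.
  suffices h : ∑ s ∈ Finset.range t, weight I i s ^ 2 ≤ 2 - 2 / ((pulls I i t : ℝ) + 1) by
    have : 0 ≤ 2 / ((pulls I i t : ℝ) + 1) := by positivity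
    linarith
  induction t with
  | zero => simp [pulls_zero]
  | succ t ih =>
    rw [Finset.sum_range_succ, pulls_succ]
    unfold weight at ih ⊢
    split_ifs
    · have h : (((pulls I i t : ℝ) + 1)⁻¹) ^ 2
          ≤ 2 / ((pulls I i t : ℝ) + 1) - 2 / ((pulls I i t : ℝ) + 1 + 1) := by
        rw [div_sub_div _ _ (by positivity) (by positivity), inv_pow, inv_eq_one_div,
          div_le_div_iff₀ (by positivity) (by positivity)]
        have : (0 : ℝ) ≤ pulls I i t := Nat.cast_nonneg _
        nlinarith
      push_cast
      linarith
    · simpa using ih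

/-- Kronecker's lemma along the pulls of arm `i`: summation by parts turns the convergence of
`∑ weight * (x - m)` into the convergence of the sample mean. -/
lemma tendsto_total_div_pulls {k : ℕ} (I : ℕ → Fin k) (x : Fin k → ℕ → ℝ) (i : Fin k) {m U : ℝ}
    (hU : Tendsto (fun t => ∑ s ∈ Finset.range t, weight I i s * (x i s - m)) atTop (𝓝 U))
    (hN : Tendsto (pulls I i) atTop atTop) :
    Tendsto (fun t => total I x i t / pulls I i t) atTop (𝓝 m) := by
  set S : ℕ → ℝ := fun t => ∑ s ∈ Finset.range t, weight I i s * (x i s - m) with hS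
  set a : ℕ → ℝ := fun s => if I s = i then 1 else 0 with ha
  have hsum : ∀ t, ∑ s ∈ Finset.range t, a s = pulls I i t := fun t => by
    simp [ha, pulls]
  have hN' : Tendsto (fun t => (pulls I i t : ℝ)) atTop atTop :=
    tendsto_natCast_atTop_atTop.comp hN
  have hparts : ∀ t, total I x i t
      = pulls I i t * (m + (S t - U)) - ∑ s ∈ Finset.range t, a s * (S s - U) := by
    intro t
    induction t with
    | zero => simp [total, pulls_zero]
    | succ t ih =>
      have hSs : S (t + 1) = S t + weight I i t * (x i t - m) := Finset.sum_range_succ _ _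
      rw [total_succ, ih, pulls_succ, Finset.sum_range_succ, hSs]
      simp only [ha, weight]
      split_ifs
      · have : (pulls I i t : ℝ) + 1 ≠ 0 := by positivity
        push_cast
        field_simp
        ring
      · simp
  have hSU : Tendsto (fun t => S t - U) atTop (𝓝 0) := by
    simpa using hU.sub_const U
  have hlittle : (fun t => ∑ s ∈ Finset.range t, a s * (S s - U)) =o[atTop]
      fun t => ∑ s ∈ Finset.range t, a s := by
    refine Asymptotics.IsLittleO.sum_range ?_ (fun s => ?_) (by simpa only [hsum] using hN')
    · simpa using (Asymptotics.isBigO_refl a atTop).mul_isLittleO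
        ((Asymptotics.isLittleO_one_iff ℝ).2 hSU)
    · simp only [ha, Pi.zero_apply]
      split_ifs <;> simp
  simp only [hsum] at hlittle
  have hlim : Tendsto (fun t => (m + (S t - U))
      - (∑ s ∈ Finset.range t, a s * (S s - U)) / pulls I i t) atTop (𝓝 m) := by
    simpa using (hSU.const_add m).sub hlittle.tendsto_div_nhds_zero
  refine hlim.congr' ?_
  filter_upwards [hN'.eventually_gt_atTop 0] with t ht
  rw [hparts]
  field_simp

/-- The sample mean of arm `i` converges to `μ i` almost surely on the event that the arm is
pulled infinitely often. -/
lemma ae_tendsto_total_div_pulls {k : ℕ} {μ σ : Fin k → ℝ}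
    {Ω : Type*} [mΩ : MeasurableSpace Ω] {P : Measure Ω} [IsProbabilityMeasure P]
    {X : Fin k → ℕ → Ω → ℝ} (hX : IsRewards P μ σ X)
    {ℱ : Filtration ℕ mΩ} {I : ℕ → Ω → Fin k} (hI : IsNonanticipating P ℱ X I) (i : Fin k) :
    ∀ᵐ ω ∂P, Tendsto (pulls (fun s => I s ω) i) atTop atTop →
      Tendsto (fun t => total (fun s => I s ω) (fun j s => X j s ω) i t
        / pulls (fun s => I s ω) i t) atTop (𝓝 (μ i)) := by
  -- The choice of round `u` is known before that round, hence so are the numbers of pulls after it.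
  have hpm : ∀ t u, t ≤ u + 1 → Measurable[ℱ u] fun ω => (pulls (fun s => I s ω) i t : ℝ) := by
    intro t
    induction t with
    | zero =>
      intro u _
      simp only [pulls_zero]
      exact measurable_const
    | succ t ih =>
      intro u htu
      simp only [pulls_succ, Nat.cast_add, Nat.cast_ite]
      have hset : MeasurableSet[ℱ u] {ω | I t ω = i} :=
        ((hI.choice t).mono (ℱ.mono (by omega)) le_rfl) (measurableSet_singleton i)
      exact (ih u (by omega)).add (Measurable.ite hset measurable_const measurable_const)
  have hmem : ∀ t, MemLp (X i t) 2 P := fun t => by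
    have h := memLp_id_gaussianReal' (μ := μ i) (v := Real.toNNReal (σ i ^ 2)) 2 (by simp)
    rw [← hX.law i t] at h
    exact (memLp_map_measure_iff aestronglyMeasurable_id (hX.measurable i t).aemeasurable).1 h
  have hmean : ∀ t, ∫ ω, X i t ω ∂P = μ i := fun t => by
    have h := integral_id_gaussianReal (μ := μ i) (v := Real.toNNReal (σ i ^ 2))
    rw [← hX.law i t, integral_map (f := fun x => x) (hX.measurable i t).aemeasurable
      measurable_id.aestronglyMeasurable] at h
    exact h
  have hvar : ∀ t, ∫ ω, (X i t ω - μ i) ^ 2 ∂P = σ i ^ 2 := fun t => by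
    have h := variance_id_gaussianReal (μ := μ i) (v := Real.toNNReal (σ i ^ 2))
    rw [variance_eq_integral aemeasurable_id, ← hX.law i t,
      integral_map (hX.measurable i t).aemeasurable
        (by fun_prop), hX.law i t] at h
    simpa [integral_id_gaussianReal, sq_nonneg] using h
  have hconv := ae_exists_tendsto_sum_predictable_mul (P := P) ℱ
    (c := fun t ω => weight (fun s => I s ω) i t) (Y := fun t ω => X i t ω - μ i)
    (B := 2) (V := σ i ^ 2) (fun t => ?_) (fun t ω => abs_weight_le_one _ _ _)
    (fun t ω => sum_weight_sq_le _ _ _) (fun s t hst => (hI.past i s t hst).sub_const _)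
    (fun t => (hmem t).sub (memLp_const _)) (fun t => ?_) hvar (fun t => ?_)
  · filter_upwards [hconv] with ω ⟨U, hU⟩ hN
    exact tendsto_total_div_pulls _ (fun j s => X j s ω) i hU hN
  · have hset : MeasurableSet[ℱ t] {ω | I t ω = i} :=
      (hI.choice t) (measurableSet_singleton i)
    exact Measurable.ite hset ((hpm t t (by omega)).add_const 1).inv measurable_const
  · rw [integral_sub ((hmem t).integrable one_le_two) (integrable_const _), hmean]
    simp
  · refine indep_of_indep_of_le_right (hI.indep t) ?_
    have h : (fun ω => X i t ω - μ i) = (fun v : Fin k → ℝ => v i - μ i) ∘ fun ω j => X j t ω := rfl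
    rw [h, ← MeasurableSpace.comap_comp]
    exact MeasurableSpace.comap_mono
      (by fun_prop : Measurable fun v : Fin k → ℝ => v i - μ i).comap_le

/-! ### The knowledge gradient in closed form -/

lemma var_knowledge {k : ℕ} (σ : Fin k → ℝ) (I : ℕ → Fin k) (x : Fin k → ℕ → ℝ) (i : Fin k)
    (t : ℕ) : (knowledge σ I x t).var i
      = ((pulls I i t : ℝ≥0∞) * (ENNReal.ofReal (σ i ^ 2))⁻¹)⁻¹ := by
  induction t with
  | zero => simp [knowledge, prior, pulls_zero]
  | succ t ih =>
    rw [pulls_succ]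
    simp only [knowledge, Knowledge.update]
    split_ifs
    · rw [ih, postVar, inv_inv]
      push_cast
      rw [add_mul, one_mul]
    · simpa using ih

/-- The posterior mean is the sample mean, stated without division to cover arms not pulled
yet. -/
lemma pulls_mul_mean_knowledge {k : ℕ} {σ : Fin k → ℝ} (hσ : ∀ i, 0 < σ i) (I : ℕ → Fin k)
    (x : Fin k → ℕ → ℝ) (i : Fin k) (t : ℕ) :
    pulls I i t * (knowledge σ I x t).mean i = total I x i t := by
  induction t with
  | zero => simp [total, pulls_zero]
  | succ t ih =>
    rw [pulls_succ, total_succ, ← ih]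
    simp only [knowledge, Knowledge.update]
    by_cases h : I t = i
    · have hl : (((knowledge σ I x t).var i)⁻¹).toReal = pulls I i t * (σ i ^ 2)⁻¹ := by
        rw [var_knowledge, inv_inv, ENNReal.toReal_mul, ENNReal.toReal_inv,
          ENNReal.toReal_ofReal (sq_nonneg _), ENNReal.toReal_natCast]
      have hs := (hσ i).ne'
      have hn : (pulls I i t : ℝ) + 1 ≠ 0 := by positivity
      subst h
      simp only [if_true, postMean, hl]
      push_cast
      field_simp
    · simp [h]

lemma mean_knowledge_succ_of_ne {k : ℕ} {σ : Fin k → ℝ} {I : ℕ → Fin k}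
    {x : Fin k → ℕ → ℝ} {i : Fin k} {t : ℕ} (h : I t ≠ i) :
    (knowledge σ I x (t + 1)).mean i = (knowledge σ I x t).mean i := by
  simp [knowledge, Knowledge.update, h]

/-- The distance of the posterior mean of arm `i` to the best posterior mean of the other arms. -/
noncomputable def gap {k : ℕ} (θ : Fin k → ℝ) (i : Fin k) : ℝ :=
  |θ i - ⨆ j : {j : Fin k // j ≠ i}, θ j|

/-- The real value of `ζ` for an arm with standard deviation `s` after `n ≥ 1` pulls. -/
noncomputable def step (s : ℝ) (n : ℕ) : ℝ :=
  √(s ^ 2 / n - s ^ 2 / (n + 1))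

lemma step_sq_arg {s : ℝ} {n : ℕ} (hn : 1 ≤ n) :
    s ^ 2 / n - s ^ 2 / (n + 1) = s ^ 2 / (n * (n + 1)) := by
  have : (0 : ℝ) < n := by exact_mod_cast hn
  field_simp
  ring

lemma step_le {s : ℝ} (hs : 0 < s) {n : ℕ} (hn : 1 ≤ n) : step s n ≤ s / n := by
  have : (0 : ℝ) < n := by exact_mod_cast hn
  rw [step, step_sq_arg hn]
  refine Real.sqrt_le_iff.2 ⟨by positivity, ?_⟩
  rw [div_pow, sq (n : ℝ)]
  gcongr
  linarith

lemma le_step {s : ℝ} (hs : 0 < s) {n : ℕ} (hn : 1 ≤ n) : s / (n + 1) ≤ step s n := by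
  have : (0 : ℝ) < n := by exact_mod_cast hn
  rw [step, step_sq_arg hn]
  refine Real.le_sqrt_of_sq_le ?_
  rw [div_pow, sq ((n : ℝ) + 1)]
  gcongr
  linarith

lemma step_pos {s : ℝ} (hs : 0 < s) {n : ℕ} (hn : 1 ≤ n) : 0 < step s n :=
  lt_of_lt_of_le (by positivity) (le_step hs hn)

lemma gap_nonneg {k : ℕ} (θ : Fin k → ℝ) (i : Fin k) : 0 ≤ gap θ i := abs_nonneg _

lemma value_knowledge_of_pulls_eq_zero {k : ℕ} (σ : Fin k → ℝ)
    {I : ℕ → Fin k} (x : Fin k → ℕ → ℝ) {i : Fin k} {t : ℕ} (h : pulls I i t = 0) :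
    value σ (knowledge σ I x t) i = ∞ := by
  have hz : zeta σ (knowledge σ I x t) i = ∞ := by
    simp [zeta, var_knowledge, h, postVar]
  rw [value, hz]
  refine ENNReal.top_mul ?_
  have := f_neg_pos le_rfl
  simpa using this

lemma value_knowledge_of_one_le_pulls {k : ℕ} {σ : Fin k → ℝ} (hσ : ∀ i, 0 < σ i)
    {I : ℕ → Fin k} (x : Fin k → ℕ → ℝ) {i : Fin k} {t : ℕ} (h : 1 ≤ pulls I i t) :
    value σ (knowledge σ I x t) i = ENNReal.ofReal (step (σ i) (pulls I i t) *
      f (-(gap (knowledge σ I x t).mean i / step (σ i) (pulls I i t)))) := by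
  have hs : 0 < σ i ^ 2 := pow_pos (hσ i) 2
  have hinv : ∀ m : ℕ, 1 ≤ m →
      ((m : ℝ≥0∞) * (ENNReal.ofReal (σ i ^ 2))⁻¹)⁻¹ = ENNReal.ofReal (σ i ^ 2 / m) := by
    intro m hm
    have hm0 : (0 : ℝ) < m := by exact_mod_cast hm
    rw [← ENNReal.ofReal_natCast, ← ENNReal.ofReal_inv_of_pos hs,
      ← ENNReal.ofReal_mul hm0.le, ← ENNReal.ofReal_inv_of_pos (by positivity)]
    congr 1
    field_simp
  have hz : zeta σ (knowledge σ I x t) i = ENNReal.ofReal (step (σ i) (pulls I i t)) := by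
    have h1 := hinv _ h
    have h2 := hinv (pulls I i t + 1) (by omega)
    push_cast [add_mul] at h2
    rw [one_mul] at h2
    rw [zeta, postVar, var_knowledge, inv_inv, h2, h1, ← ENNReal.ofReal_sub _ (by positivity),
      ENNReal.ofReal_rpow_of_nonneg _ (by norm_num), ← Real.sqrt_eq_rpow, step]
    rw [step_sq_arg h]
    positivity
  have hp := step_pos (hσ i) h
  rw [value, hz, ← ENNReal.ofReal_div_of_pos hp, ENNReal.toReal_ofReal
    (div_nonneg (abs_nonneg _) hp.le), ← ENNReal.ofReal_mul hp.le, gap]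

/-! ### Every arm is pulled infinitely often -/

lemma tendsto_pulls_or_eventually_ne {k : ℕ} (I : ℕ → Fin k) (i : Fin k) :
    Tendsto (pulls I i) atTop atTop ∨
      ∃ T, ∀ t, T ≤ t → I t ≠ i ∧ pulls I i t = pulls I i T := by
  rcases tendsto_atTop_of_monotone (pulls_mono I i) with h | ⟨n, hn⟩
  · exact Or.inl h
  · right
    rw [nhds_discrete, tendsto_pure, eventually_atTop] at hn
    obtain ⟨T, hT⟩ := hn
    refine ⟨T, fun t ht => ⟨fun hi => ?_, (hT t ht).trans (hT T le_rfl).symm⟩⟩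
    have h1 := hT (t + 1) (by omega)
    rw [pulls_succ, hT t ht, if_pos hi] at h1
    omega

lemma tendsto_mean_knowledge {k : ℕ} {σ : Fin k → ℝ} (hσ : ∀ i, 0 < σ i) {I : ℕ → Fin k}
    {x : Fin k → ℕ → ℝ} {i : Fin k} {m : ℝ} (hN : Tendsto (pulls I i) atTop atTop)
    (h : Tendsto (fun t => total I x i t / pulls I i t) atTop (𝓝 m)) :
    Tendsto (fun t => (knowledge σ I x t).mean i) atTop (𝓝 m) := by
  refine h.congr' ?_
  filter_upwards [hN.eventually_ge_atTop 1] with t ht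
  have : (0 : ℝ) < pulls I i t := by exact_mod_cast ht
  rw [← pulls_mul_mean_knowledge hσ]
  field_simp

lemma exists_tendsto_mean_knowledge {k : ℕ} {σ : Fin k → ℝ} (hσ : ∀ i, 0 < σ i)
    {I : ℕ → Fin k} {x : Fin k → ℕ → ℝ} {i : Fin k} {m : ℝ}
    (h : Tendsto (pulls I i) atTop atTop →
      Tendsto (fun t => total I x i t / pulls I i t) atTop (𝓝 m)) :
    ∃ c, Tendsto (fun t => (knowledge σ I x t).mean i) atTop (𝓝 c) := by
  rcases tendsto_pulls_or_eventually_ne I i with hN | ⟨T, hT⟩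
  · exact ⟨m, tendsto_mean_knowledge hσ hN (h hN)⟩
  · refine ⟨(knowledge σ I x T).mean i, tendsto_atTop_of_eventually_const (i₀ := T) ?_⟩
    intro t ht
    induction t, ht using Nat.le_induction with
    | base => rfl
    | succ t ht ih => rw [mean_knowledge_succ_of_ne (hT t ht).1, ih]

lemma tendsto_gap {k : ℕ} (hk : 2 ≤ k) {θ : ℕ → Fin k → ℝ} {m : Fin k → ℝ}
    (h : ∀ i, Tendsto (fun t => θ t i) atTop (𝓝 (m i))) (i : Fin k) :
    Tendsto (fun t => gap (θ t) i) atTop (𝓝 (gap m i)) := by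
  have : Nontrivial (Fin k) := Fin.nontrivial_iff_two_le.2 hk
  obtain ⟨j, hj⟩ := exists_ne i
  have : Nonempty {j : Fin k // j ≠ i} := ⟨⟨j, hj⟩⟩
  have hsup : Tendsto (fun t => ⨆ j : {j : Fin k // j ≠ i}, θ t j) atTop
      (𝓝 (⨆ j : {j : Fin k // j ≠ i}, m j)) := by
    simp only [← Finset.sup'_univ_eq_ciSup]
    exact Tendsto.finset_sup'_nhds_apply _ fun j _ => h j
  exact ((h i).sub hsup).abs

/-- An arm pulled finitely often would keep a knowledge gradient bounded away from zero, whereas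
the knowledge gradients of the arms pulled infinitely often tend to zero. -/
lemma tendsto_pulls_atTop {k : ℕ} (hk : 2 ≤ k) {σ : Fin k → ℝ} (hσ : ∀ i, 0 < σ i)
    {I : ℕ → Fin k} {x : Fin k → ℕ → ℝ} (hrun : IsRun σ x I)
    (hmean : ∀ i, ∃ c, Tendsto (fun t => (knowledge σ I x t).mean i) atTop (𝓝 c)) (i : Fin k) :
    Tendsto (pulls I i) atTop atTop := by
  rcases tendsto_pulls_or_eventually_ne I i with hN | ⟨T, hT⟩
  · exact hN
  exfalso
  choose m hm using hmean
  have hgap := tendsto_gap hk hm i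
  obtain ⟨c, hc0, hc⟩ : ∃ c : ℝ, 0 < c ∧
      ∀ᶠ t in atTop, ENNReal.ofReal c ≤ value σ (knowledge σ I x t) i := by
    rcases Nat.eq_zero_or_pos (pulls I i T) with h0 | h0
    · refine ⟨1, one_pos, ?_⟩
      filter_upwards [eventually_ge_atTop T] with t ht
      rw [value_knowledge_of_pulls_eq_zero σ x ((hT t ht).2.trans h0)]
      exact le_top
    · have hp := step_pos (hσ i) h0
      refine ⟨step (σ i) (pulls I i T) * gaussianPDFReal 0 1
        ((gap m i + 1) / step (σ i) (pulls I i T) + 2),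
        mul_pos hp (gaussianPDFReal_pos _ _ _ one_ne_zero), ?_⟩
      filter_upwards [eventually_ge_atTop T, hgap.eventually_le_const (lt_add_one _)]
        with t ht hg
      have ht2 := (hT t ht).2
      rw [value_knowledge_of_one_le_pulls hσ x (ht2 ▸ h0), ht2]
      refine ENNReal.ofReal_le_ofReal (mul_le_mul_of_nonneg_left ?_ hp.le)
      have h1 : 0 ≤ gap (knowledge σ I x t).mean i / step (σ i) (pulls I i T) :=
        div_nonneg (gap_nonneg _ _) hp.le
      refine le_trans (gaussianPDFReal_zero_one_anti (by linarith) ?_) (le_f_neg h1)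
      gcongr
  obtain ⟨j, hj⟩ := Finite.exists_infinite_fiber I
  have hfreq : ∃ᶠ t in atTop, I t = j :=
    Nat.frequently_atTop_iff_infinite.2 (Set.infinite_coe_iff.1 hj)
  have hNj : Tendsto (pulls I j) atTop atTop := by
    rcases tendsto_pulls_or_eventually_ne I j with hN | ⟨T', hT'⟩
    · exact hN
    · exact absurd hfreq (not_frequently.2 ((eventually_ge_atTop T').mono fun t ht => (hT' t ht).1))
  have hlim : Tendsto (fun t => σ j / (pulls I j t : ℝ) * gaussianPDFReal 0 1 0) atTop (𝓝 0) := by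
    simpa using ((tendsto_natCast_atTop_atTop.comp hNj).const_div_atTop (σ j)).mul_const
      (gaussianPDFReal 0 1 0)
  obtain ⟨t, htj, hct, htl, htN⟩ := (hfreq.and_eventually
    (hc.and ((hlim.eventually_lt_const hc0).and (hNj.eventually_ge_atTop 1)))).exists
  refine (hct.trans (hrun t i)).not_gt ?_
  rw [htj, value_knowledge_of_one_le_pulls hσ x htN]
  refine (ENNReal.ofReal_lt_ofReal_iff hc0).2 (lt_of_le_of_lt ?_ htl)
  have hp := step_pos (hσ j) htN
  have h1 : 0 ≤ gap (knowledge σ I x t).mean j / step (σ j) (pulls I j t) :=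
    div_nonneg (gap_nonneg _ _) hp.le
  have h2 := (f_neg_le h1).trans (gaussianPDFReal_zero_one_anti le_rfl h1)
  exact mul_le_mul (step_le (hσ j) htN) h2 (f_neg_pos h1).le (hp.le.trans (step_le (hσ j) htN))

/-! ### Ratios of the numbers of pulls -/

/-- In every late round in which arm `i` is pulled, its normalized gap exceeds that of any other
arm `j` by at most a factor `1 + ε`: otherwise the Gaussian tail would make its knowledge gradient
smaller than that of `j`. -/
lemma eventually_div_step_le {k : ℕ} {σ : Fin k → ℝ} (hσ : ∀ i, 0 < σ i)
    {I : ℕ → Fin k} {x : Fin k → ℕ → ℝ} (hrun : IsRun σ x I)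
    (hN : ∀ i, Tendsto (pulls I i) atTop atTop) {D : Fin k → ℝ} (hD : ∀ i, 0 < D i)
    (hgap : ∀ i, Tendsto (fun t => gap (knowledge σ I x t).mean i) atTop (𝓝 (D i)))
    (i j : Fin k) {ε : ℝ} (hε : 0 < ε) :
    ∀ᶠ t in atTop, I t = i → gap (knowledge σ I x t).mean i / step (σ i) (pulls I i t)
      ≤ (1 + ε) * (gap (knowledge σ I x t).mean j / step (σ j) (pulls I j t)) := by
  have hC : 0 < D j / (2 * D i) := div_pos (hD j) (mul_pos two_pos (hD i))
  have hCgap : ∀ᶠ t in atTop, D j / (2 * D i) * gap (knowledge σ I x t).mean i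
      < gap (knowledge σ I x t).mean j := by
    refine ((hgap i).const_mul (D j / (2 * D i))).eventually_lt (hgap j) ?_
    have hi := hD i
    have hj := hD j
    field_simp
    linarith
  have hgj : Tendsto (fun t => gap (knowledge σ I x t).mean j / step (σ j) (pulls I j t))
      atTop atTop := by
    have h1 : Tendsto (fun t => gap (knowledge σ I x t).mean j * ((pulls I j t : ℝ) / σ j))
        atTop atTop :=
      (hgap j).pos_mul_atTop (hD j)
        ((tendsto_natCast_atTop_atTop.comp (hN j)).atTop_div_const (hσ j))
    refine tendsto_atTop_mono' _ ?_ h1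
    filter_upwards [(hN j).eventually_ge_atTop 1] with t ht
    rw [div_eq_mul_inv (gap _ _), ← inv_div (σ j)]
    exact mul_le_mul_of_nonneg_left
      (inv_anti₀ (step_pos (hσ j) ht) (step_le (hσ j) ht)) (gap_nonneg _ _)
  filter_upwards [hCgap, (hgap i).eventually_const_lt (hD i), (hgap j).eventually_const_lt (hD j),
    hgj.eventually (eventually_gaussianPDFReal_lt hε hC), (hN i).eventually_ge_atTop 1,
    (hN j).eventually_ge_atTop 1] with t hCt hDi hDj htail hNi hNj hIt
  have hzi := step_pos (hσ i) hNi
  have hzj := step_pos (hσ j) hNj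
  have hv := hrun t j
  rw [hIt, value_knowledge_of_one_le_pulls hσ x hNi,
    value_knowledge_of_one_le_pulls hσ x hNj] at hv
  set zi := step (σ i) (pulls I i t)
  set zj := step (σ j) (pulls I j t)
  set di := gap (knowledge σ I x t).mean i
  set dj := gap (knowledge σ I x t).mean j
  set C := D j / (2 * D i)
  have hgi0 : 0 < di / zi := div_pos hDi hzi
  have hgj0 : 0 < dj / zj := div_pos hDj hzj
  rw [ENNReal.ofReal_le_ofReal_iff (mul_pos hzi (f_neg_pos hgi0.le)).le] at hv
  by_contra! hlt
  have hφ : 0 < gaussianPDFReal 0 1 (dj / zj + 2) := gaussianPDFReal_pos _ _ _ one_ne_zero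
  have h1 : zj * gaussianPDFReal 0 1 (dj / zj + 2)
      < zi * (C * gaussianPDFReal 0 1 (dj / zj + 2)) :=
    calc zj * gaussianPDFReal 0 1 (dj / zj + 2) ≤ zj * f (-(dj / zj)) :=
          mul_le_mul_of_nonneg_left (le_f_neg hgj0.le) hzj.le
      _ ≤ zi * f (-(di / zi)) := hv
      _ ≤ zi * gaussianPDFReal 0 1 ((1 + ε) * (dj / zj)) :=
          mul_le_mul_of_nonneg_left ((f_neg_le hgi0.le).trans
            (gaussianPDFReal_zero_one_anti (by positivity) hlt.le)) hzi.le
      _ < _ := mul_lt_mul_of_pos_left htail hzi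
  have h2 : zj < C * zi := by
    refine lt_of_mul_lt_mul_right (h1.trans_eq ?_) hφ.le
    ring
  -- On the other hand `zj = dj / gj > C * di / gj ≥ C * di / gi = C * zi`.
  have h3 : dj / zj ≤ di / zi := by nlinarith
  rw [div_le_div_iff₀ hzj hzi] at h3
  have h4 : C * di * zi < di * zj := (mul_lt_mul_of_pos_right hCt hzi).trans_le h3
  nlinarith

/-- An asymptotic upper bound for the pulls of arm `i` by those of arm `j`. It only has to be
checked when `i` is pulled, since in the other rounds its left-hand side stays constant and its
right-hand side does not decrease. -/
lemma exists_eventually_pulls_le {k : ℕ} {σ : Fin k → ℝ} (hσ : ∀ i, 0 < σ i)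
    {I : ℕ → Fin k} {x : Fin k → ℕ → ℝ} (hrun : IsRun σ x I)
    (hN : ∀ i, Tendsto (pulls I i) atTop atTop) {D : Fin k → ℝ} (hD : ∀ i, 0 < D i)
    (hgap : ∀ i, Tendsto (fun t => gap (knowledge σ I x t).mean i) atTop (𝓝 (D i)))
    (i j : Fin k) {r : ℝ} (hr : D j / σ j / (D i / σ i) < r) :
    ∃ K : ℝ, ∀ᶠ t in atTop, (pulls I i t : ℝ) ≤ r * pulls I j t + K := by
  set κ := D j / σ j / (D i / σ i) with hκ
  have hκ0 : 0 < κ := div_pos (div_pos (hD j) (hσ j)) (div_pos (hD i) (hσ i))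
  have hr0 : 0 < r := hκ0.trans hr
  obtain ⟨ε, hε, hεr⟩ : ∃ ε : ℝ, 0 < ε ∧ (1 + ε) * κ < r := by
    refine ⟨(r - κ) / (2 * κ), div_pos (sub_pos.2 hr) (by positivity), ?_⟩
    have : (1 + (r - κ) / (2 * κ)) * κ = (r + κ) / 2 := by
      field_simp
      ring
    linarith
  have hlim : Tendsto (fun t => (1 + ε) * (gap (knowledge σ I x t).mean j / σ j
      / (gap (knowledge σ I x t).mean i / σ i))) atTop (𝓝 ((1 + ε) * κ)) :=
    (((hgap j).div_const _).div ((hgap i).div_const _)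
      (div_pos (hD i) (hσ i)).ne').const_mul _
  have hpull : ∀ᶠ t in atTop, I t = i → (pulls I i t : ℝ) ≤ r * (pulls I j t + 1) := by
    filter_upwards [eventually_div_step_le hσ hrun hN hD hgap i j hε,
      hlim.eventually_lt_const hεr, (hgap i).eventually_const_lt (hD i),
      (hN i).eventually_ge_atTop 1, (hN j).eventually_ge_atTop 1] with t ht hrt hDi hNi hNj hIt
    have hi := hσ i
    have hj := hσ j
    have hni : (0 : ℝ) < pulls I i t := by exact_mod_cast hNi
    have h1 : gap (knowledge σ I x t).mean i / σ i * pulls I i t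
        ≤ gap (knowledge σ I x t).mean i / step (σ i) (pulls I i t) := by
      rw [div_mul_eq_mul_div, ← div_div_eq_mul_div]
      exact div_le_div_of_nonneg_left hDi.le (step_pos hi hNi) (step_le hi hNi)
    have h2 : gap (knowledge σ I x t).mean j / step (σ j) (pulls I j t)
        ≤ gap (knowledge σ I x t).mean j / σ j * (pulls I j t + 1) := by
      rw [div_mul_eq_mul_div, ← div_div_eq_mul_div]
      exact div_le_div_of_nonneg_left (gap_nonneg _ _) (by positivity) (le_step hj hNj)
    have hci : 0 < gap (knowledge σ I x t).mean i / σ i := div_pos hDi hi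
    have h3 : (1 + ε) * (gap (knowledge σ I x t).mean j / σ j)
        ≤ r * (gap (knowledge σ I x t).mean i / σ i) := by
      rw [← mul_div_assoc, div_lt_iff₀ hci] at hrt
      exact hrt.le
    refine le_of_mul_le_mul_left ?_ hci
    calc _ ≤ (1 + ε) * (gap (knowledge σ I x t).mean j / σ j * (pulls I j t + 1)) :=
          (h1.trans (ht hIt)).trans (mul_le_mul_of_nonneg_left h2 (by positivity))
      _ = (1 + ε) * (gap (knowledge σ I x t).mean j / σ j) * (pulls I j t + 1) := by ring
      _ ≤ r * (gap (knowledge σ I x t).mean i / σ i) * (pulls I j t + 1) :=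
          mul_le_mul_of_nonneg_right h3 (by positivity)
      _ = _ := by ring
  obtain ⟨T, hT⟩ := eventually_atTop.1 hpull
  refine ⟨r + 1 + pulls I i T, eventually_atTop.2 ⟨T, fun t ht => ?_⟩⟩
  have hT0 : (0 : ℝ) ≤ pulls I i T := Nat.cast_nonneg _
  induction t, ht using Nat.le_induction with
  | base =>
    have : 0 ≤ r * pulls I j T := by positivity
    linarith
  | succ t ht ih =>
    have hmono : r * (pulls I j t : ℝ) ≤ r * pulls I j (t + 1) :=
      mul_le_mul_of_nonneg_left (by exact_mod_cast pulls_mono I j t.le_succ) hr0.le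
    rw [pulls_succ I i]
    split_ifs with h
    · have := hT t ht h
      push_cast
      linarith
    · push_cast
      linarith

lemma tendsto_pulls_div_pulls {k : ℕ} {σ : Fin k → ℝ} (hσ : ∀ i, 0 < σ i)
    {I : ℕ → Fin k} {x : Fin k → ℕ → ℝ} (hrun : IsRun σ x I)
    (hN : ∀ i, Tendsto (pulls I i) atTop atTop) {D : Fin k → ℝ} (hD : ∀ i, 0 < D i)
    (hgap : ∀ i, Tendsto (fun t => gap (knowledge σ I x t).mean i) atTop (𝓝 (D i)))
    (i j : Fin k) :
    Tendsto (fun t => (pulls I i t : ℝ) / pulls I j t) atTop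
      (𝓝 (D j / σ j / (D i / σ i))) := by
  have hN' : ∀ i, Tendsto (fun t => (pulls I i t : ℝ)) atTop atTop := fun i =>
    tendsto_natCast_atTop_atTop.comp (hN i)
  have hupper : ∀ i j : Fin k, ∀ r, D j / σ j / (D i / σ i) < r →
      ∀ᶠ t in atTop, (pulls I i t : ℝ) / pulls I j t < r := by
    intro i j r hr
    obtain ⟨r', hr', hr'r⟩ := exists_between hr
    obtain ⟨K, hK⟩ := exists_eventually_pulls_le hσ hrun hN hD hgap i j hr'
    filter_upwards [hK, (hN' j).eventually_gt_atTop 0,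
      (hN' j).eventually_gt_atTop (K / (r - r'))] with t ht h0 h1
    rw [div_lt_iff₀ h0]
    rw [div_lt_iff₀ (sub_pos.2 hr'r)] at h1
    linarith
  refine tendsto_order.2 ⟨fun r hr => ?_, hupper i j⟩
  have hpos : ∀ᶠ t in atTop, 0 < (pulls I i t : ℝ) ∧ 0 < (pulls I j t : ℝ) :=
    ((hN' i).eventually_gt_atTop 0).and ((hN' j).eventually_gt_atTop 0)
  rcases le_or_gt r 0 with h0 | h0
  · filter_upwards [hpos] with t ht
    exact h0.trans_lt (div_pos ht.1 ht.2)
  · have h1 : D i / σ i / (D j / σ j) < r⁻¹ := by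
      rw [← inv_div]
      exact inv_strictAnti₀ h0 hr
    filter_upwards [hpos, hupper j i _ h1] with t ht h2
    rw [← inv_div] at h2
    exact (inv_lt_inv₀ (div_pos ht.1 ht.2) h0).1 h2

/-! ### The gaps of the true means -/

lemma gap_of_ne_best {k : ℕ} {μ : Fin k → ℝ} {b : Fin k} (hb : ∀ i, i ≠ b → μ i < μ b)
    {i : Fin k} (hi : i ≠ b) : gap μ i = μ b - μ i := by
  have : Nonempty {j : Fin k // j ≠ i} := ⟨⟨b, hi.symm⟩⟩
  have hsup : ⨆ j : {j : Fin k // j ≠ i}, μ j = μ b := by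
    refine le_antisymm (ciSup_le fun j => ?_)
      (le_ciSup (f := fun j : {j : Fin k // j ≠ i} => μ j) (Set.finite_range _).bddAbove
        ⟨b, hi.symm⟩)
    rcases eq_or_ne (j : Fin k) b with h | h
    · rw [h]
    · exact (hb _ h).le
  rw [gap, hsup, abs_sub_comm, abs_of_pos (sub_pos.2 (hb i hi))]

lemma gap_best {k : ℕ} (hk : 2 ≤ k) {μ : Fin k → ℝ} {b : Fin k}
    (hb : ∀ i, i ≠ b → μ i < μ b) :
    gap μ b = μ b - ⨆ j : {j : Fin k // j ≠ b}, μ j ∧ 0 < gap μ b := by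
  have : Nontrivial (Fin k) := Fin.nontrivial_iff_two_le.2 hk
  obtain ⟨j, hj⟩ := exists_ne b
  have : Nonempty {j : Fin k // j ≠ b} := ⟨⟨j, hj⟩⟩
  obtain ⟨i, hi⟩ := exists_eq_ciSup_of_finite (f := fun j : {j : Fin k // j ≠ b} => μ j)
  have hpos : 0 < μ b - ⨆ j : {j : Fin k // j ≠ b}, μ j := by
    rw [← hi]
    exact sub_pos.2 (hb i i.2)
  have h : gap μ b = μ b - ⨆ j : {j : Fin k // j ≠ b}, μ j := abs_of_pos hpos
  exact ⟨h, h ▸ hpos⟩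

end KG

theorem corollary1 {k : ℕ} (hk : 2 ≤ k) (μ σ : Fin k → ℝ) (hσ : ∀ i, 0 < σ i)
    (b : Fin k) (hb : ∀ i, i ≠ b → μ i < μ b)
    {Ω : Type*} [mΩ : MeasurableSpace Ω] (P : Measure Ω) [IsProbabilityMeasure P]
    (X : Fin k → ℕ → Ω → ℝ) (hX : KG.IsRewards P μ σ X)
    (ℱ : Filtration ℕ mΩ) (I : ℕ → Ω → Fin k) (hI : KG.IsNonanticipating P ℱ X I)
    (hKG : ∀ᵐ ω ∂P, KG.IsRun σ (fun i t => X i t ω) (fun t => I t ω)) :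
    (∀ i, i ≠ b → ∀ᵐ ω ∂P,
      Tendsto (fun t => (KG.pulls (fun s => I s ω) i t : ℝ) / (KG.pulls (fun s => I s ω) b t : ℝ))
        atTop (𝓝 (σ i / σ b * ((μ b - ⨆ j : {j : Fin k // j ≠ b}, μ j) / (μ b - μ i))))) ∧
    (∀ i₁ i₂, i₁ ≠ b → i₂ ≠ b → ∀ᵐ ω ∂P,
      Tendsto (fun t => (KG.pulls (fun s => I s ω) i₁ t : ℝ) / (KG.pulls (fun s => I s ω) i₂ t : ℝ))
        atTop (𝓝 (σ i₁ / σ i₂ * ((μ b - μ i₂) / (μ b - μ i₁))))) := by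
  have hall : ∀ᵐ ω ∂P, ∀ i j, Tendsto (fun t => (KG.pulls (fun s => I s ω) i t : ℝ)
      / (KG.pulls (fun s => I s ω) j t : ℝ)) atTop
      (𝓝 (KG.gap μ j / σ j / (KG.gap μ i / σ i))) := by
    filter_upwards [hKG, ae_all_iff.2 (KG.ae_tendsto_total_div_pulls hX hI)] with ω hrun hmean i j
    have hN := KG.tendsto_pulls_atTop hk hσ hrun fun i =>
      KG.exists_tendsto_mean_knowledge hσ (hmean i)
    have hD : ∀ i, 0 < KG.gap μ i := fun i => by
      rcases eq_or_ne i b with rfl | hi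
      · exact (KG.gap_best hk hb).2
      · rw [KG.gap_of_ne_best hb hi]
        exact sub_pos.2 (hb i hi)
    exact KG.tendsto_pulls_div_pulls hσ hrun hN hD
      (KG.tendsto_gap hk fun i => KG.tendsto_mean_knowledge hσ (hN i) (hmean i (hN i))) i j
  refine ⟨fun i hi => ?_, fun i₁ i₂ h₁ h₂ => ?_⟩
  · filter_upwards [hall] with ω hω
    have h := hω i b
    rw [(KG.gap_best hk hb).1, KG.gap_of_ne_best hb hi, div_div_div_eq, mul_comm, mul_comm (σ b),
      mul_comm (μ b - μ i) (σ b), mul_div_mul_comm] at h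
    exact h
  · filter_upwards [hall] with ω hω
    have h := hω i₁ i₂
    rw [KG.gap_of_ne_best hb h₁, KG.gap_of_ne_best hb h₂, div_div_div_eq, mul_comm,
      mul_div_mul_comm] at h
    exact h
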